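/- Let $\tau>0$, $c\ge 0$, $x\in H^1([0,\tau];\mathbb R^n)$ and $u\in L^2([0,\tau];\mathbb R^m)$. Let $H^1_0[0,\tau]$ carry the inner product $\langle\phi,\psi\rangle=\int_0^\tau\phi'(t)\psi'(t)\,dt$. For $f\in L^2([0,\tau];\mathbb R^k)$, the synthesis operator and the differentiated synthesis operator associated with $f$ are the bounded operators $T,T_{\mathrm d}\colon H^1_0[0,\tau]\to\mathbb R^k$, $$T\phi=\int_0^\tau\phi(t)f(t)\,dt,\qquad T_{\mathrm d}\phi=-\int_0^\tau\phi'(t)f(t)\,dt .$$ Let $\Xi$ and $\Xi_{\mathrm d}$ be the synthesis operator and the differentiated synthesis operator associated with $x$, and let $\Upsilon$ be the synthesis operator associated with $u$. Let $\Delta_c[0,\tau]$ be the set of all $w\in L^2([0,\tau];\mathbb R^n)$ whose synthesis operator $W$ satisfies $WW^*\preceq cI_n$, and let $\Sigma_c$ be the set of all pairs $(A,B)\in\mathbb R^{n\times n}\times\mathbb R^{n\times m}$ for which there is $w\in\Delta_c[0,\tau]$ with $x'=Ax+Bu+w$ a.e. on $[0,\tau]$. The data $(x,u,\tau)$ are called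 informative for quadratic stabilization under the noise class $\Delta_c[0,\tau]$ if there exist a symmetric $P\succ0$ in $\mathbb R^{n\times n}$ and $K\in\mathbb R^{m\times n}$ such that $$(A+BK)P+P(A+BK)^\top\prec 0\qquad\text{for all }(A,B)\in\Sigma_c .$$ Theorem. Assume that there exist $A_s\in\mathbb R^{n\times n}$, $B_s\in\mathbb R^{n\times m}$ and $w_s\in\Delta_c[0,\tau]$ such that $x'(t)=A_sx(t)+B_su(t)+w_s(t)$ for a.e. $t\in[0,\tau]$. Then the following statements are equivalent: (i) The data $(x,u,\tau)$ are informative for quadratic stabilization under the noise class $\Delta_c[0,\tau]$. (ii) There exist a symmetric matrix $P\in\mathbb R^{n\times n}$, a matrix $L\in\mathbb R^{m\times n}$ and a scalar $\alpha\ge0$ such that $P\succ0$ and $$\begin{bmatrix}\alpha\,\Xi_{\mathrm d}\Xi_{\mathrm d}^*-(\alpha c+1)I_n & -P-\alpha\,\Xi_{\mathrm d}\Xi^* & -L^\top-\alpha\,\Xi_{\mathrm d}\Upsilon^*\\ -P-\alpha\,\Xi\Xi_{\mathrm d}^* & \alpha\,\Xi\Xi^* & \alpha\,\Xi\Upsilon^*\\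 -L-\alpha\,\Upsilon\Xi_{\mathrm d}^* & \alpha\,\Upsilon\Xi^* & \alpha\,\Upsilon\Upsilon^*\end{bmatrix}\succeq0 .$$ Furthermore, if $P$, $L$, $\alpha$ are as in (ii), then with $K=LP^{-1}$ the matrix $A+BK$ is Hurwitz (all its eigenvalues have negative real part) for every $(A,B)\in\Sigma_c$. -/

import Mathlib

open MeasureTheory Set
open scoped ENNReal

noncomputable section

namespace DataDriven

/-! ### The spaces `L²`, `H¹` and `H¹₀` on `[0, τ]`

Functions on `[0, τ]` are represented by functions on `ℝ` of which only the restriction to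
`[0, τ]` is used. -/

/-- Lebesgue measure on `[0, τ]`. -/
abbrev vol (τ : ℝ) : Measure ℝ := volume.restrict (Icc 0 τ)

/-- `f ∈ L²([0, τ]; E)`. -/
def MemL2 {E : Type*} [NormedAddCommGroup E] (τ : ℝ) (f : ℝ → E) : Prop :=
  MemLp f 2 (vol τ)

/-- `f ∈ H¹([0, τ]; E)`: `f` is absolutely continuous on `[0, τ]` and `f' ∈ L²([0, τ]; E)`. -/
def MemH1 {E : Type*} [NormedAddCommGroup E] [NormedSpace ℝ E] (τ : ℝ) (f : ℝ → E) : Prop :=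
  AbsolutelyContinuousOnInterval f 0 τ ∧ MemL2 τ (deriv f)

theorem ae_differentiableAt_of_ac {τ : ℝ} {f : ℝ → ℝ}
    (hf : AbsolutelyContinuousOnInterval f 0 τ) : ∀ᵐ t ∂(vol τ), DifferentiableAt ℝ f t := by
  rw [ae_restrict_iff' measurableSet_Icc]
  filter_upwards [hf.ae_differentiableAt] with t ht h
  exact ht (Icc_subset_uIcc h)

theorem deriv_add_ae {τ : ℝ} {f g : ℝ → ℝ} (hf : AbsolutelyContinuousOnInterval f 0 τ)
    (hg : AbsolutelyContinuousOnInterval g 0 τ) :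
    deriv (f + g) =ᵐ[vol τ] deriv f + deriv g := by
  filter_upwards [ae_differentiableAt_of_ac hf,
    ae_differentiableAt_of_ac hg] with t h1 h2
  simpa using deriv_add h1 h2

theorem deriv_smul_eq (c : ℝ) (f : ℝ → ℝ) : deriv (c • f) = c • deriv f := by
  ext t
  simpa using deriv_const_smul_field (x := t) c f

/-- The elements of `H¹₀[0, τ]`: the functions in `H¹[0, τ]` vanishing at `0` and at `τ`. In order
that two of them are equal as soon as they agree on `[0, τ]`, they are taken to be zero outside
`[0, τ]`. -/
def H10Sub (τ : ℝ) : Submodule ℝ (ℝ → ℝ) where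
  carrier := {φ | MemH1 τ φ ∧ φ 0 = 0 ∧ φ τ = 0 ∧ ∀ t, t ∉ Icc 0 τ → φ t = 0}
  zero_mem' := by
    refine ⟨⟨?_, ?_⟩, rfl, rfl, fun _ _ => rfl⟩
    · exact (ContDiffOn.absolutelyContinuousOnInterval (contDiff_const.contDiffOn) :
        AbsolutelyContinuousOnInterval (fun _ : ℝ => (0 : ℝ)) 0 τ)
    · have : deriv (0 : ℝ → ℝ) = 0 := by ext t; simp
      rw [this]
      exact MemLp.zero'
  add_mem' := by
    rintro f g ⟨hf, hf0, hf1, hf2⟩ ⟨hg, hg0, hg1, hg2⟩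
    refine ⟨⟨hf.1.add hg.1, ?_⟩, by simp [hf0, hg0], by simp [hf1, hg1], fun t ht => by
      simp [hf2 t ht, hg2 t ht]⟩
    exact (memLp_congr_ae (deriv_add_ae hf.1 hg.1)).2 (hf.2.add hg.2)
  smul_mem' := by
    rintro c f ⟨hf, hf0, hf1, hf2⟩
    refine ⟨⟨hf.1.const_smul c, ?_⟩, by simp [hf0], by simp [hf1], fun t ht => by
      simp [hf2 t ht]⟩
    rw [deriv_smul_eq]
    exact MemLp.const_smul hf.2 c

/-- The space `H¹₀[0, τ]`. -/
def H10 (τ : ℝ) : Type := H10Sub τ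

namespace H10

variable {τ : ℝ}

instance : AddCommGroup (H10 τ) := inferInstanceAs (AddCommGroup (H10Sub τ))

instance : Module ℝ (H10 τ) := inferInstanceAs (Module ℝ (H10Sub τ))

instance : CoeFun (H10 τ) (fun _ => ℝ → ℝ) := ⟨fun φ => φ.1⟩

theorem ac (φ : H10 τ) : AbsolutelyContinuousOnInterval φ 0 τ := φ.2.1.1

theorem memL2_deriv (φ : H10 τ) : MemLp (deriv φ) 2 (vol τ) := φ.2.1.2

theorem coe_add (φ ψ : H10 τ) : ((φ + ψ : H10 τ) : ℝ → ℝ) = (φ : ℝ → ℝ) + ψ := rfl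

theorem coe_smul (c : ℝ) (φ : H10 τ) : ((c • φ : H10 τ) : ℝ → ℝ) = c • (φ : ℝ → ℝ) := rfl

theorem deriv_add_ae (φ ψ : H10 τ) :
    deriv (φ + ψ : H10 τ) =ᵐ[vol τ] deriv (φ : ℝ → ℝ) + deriv (ψ : ℝ → ℝ) :=
  DataDriven.deriv_add_ae φ.ac ψ.ac

theorem ext {φ ψ : H10 τ} (h : ∀ t ∈ Icc 0 τ, φ t = ψ t) : φ = ψ := by
  apply Subtype.ext
  funext t
  by_cases ht : t ∈ Icc 0 τ
  · exact h t ht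
  · exact (φ.2.2.2.2 t ht).trans (ψ.2.2.2.2 t ht).symm

/-- The fundamental theorem of calculus on `H¹₀[0, τ]`. -/
theorem eq_integral (φ : H10 τ) {t : ℝ} (ht : t ∈ Icc 0 τ) :
    φ t = ∫ s in (0 : ℝ)..t, deriv φ s := by
  have h : AbsolutelyContinuousOnInterval φ 0 t := φ.ac.mono (by
    rw [uIcc_of_le ht.1, uIcc_of_le (ht.1.trans ht.2)]
    exact Icc_subset_Icc le_rfl ht.2)
  rw [h.integral_deriv_eq_sub, φ.2.2.1, sub_zero]

theorem integral_deriv (φ : H10 τ) : ∫ s, deriv φ s ∂(vol τ) = 0 := by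
  by_cases hτ : 0 ≤ τ
  · rw [integral_Icc_eq_integral_Ioc, ← intervalIntegral.integral_of_le hτ,
      φ.ac.integral_deriv_eq_sub, φ.2.2.1, φ.2.2.2.1, sub_zero]
  · simp [vol, Icc_eq_empty hτ]

theorem integrable_mul {f g : ℝ → ℝ} (hf : MemLp f 2 (vol τ)) (hg : MemLp g 2 (vol τ)) :
    Integrable (fun t => f t * g t) (vol τ) := hf.integrable_mul hg

theorem eq_zero_of_deriv {φ : H10 τ} (h : deriv φ =ᵐ[vol τ] 0) : φ = 0 := by
  apply H10.ext
  intro t ht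
  have : φ t = 0 := by
    rw [φ.eq_integral ht, intervalIntegral.integral_of_le ht.1]
    have h2 : deriv φ =ᵐ[volume.restrict (Ioc 0 t)] 0 :=
      ae_restrict_of_ae_restrict_of_subset
        (Ioc_subset_Icc_self.trans (Icc_subset_Icc le_rfl ht.2)) h
    rw [integral_congr_ae h2]
    simp
  exact this

/-- The inner product `⟨φ, ψ⟩ = ∫₀^τ φ'(t) ψ'(t) dt` of `H¹₀[0, τ]`. -/
@[reducible]
def core (τ : ℝ) : InnerProductSpace.Core ℝ (H10 τ) where
  inner φ ψ := ∫ t in Icc 0 τ, deriv φ t * deriv ψ t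
  conj_inner_symm φ ψ := by simp [mul_comm]
  re_inner_nonneg φ := integral_nonneg fun t => mul_self_nonneg _
  add_left φ ψ χ := by
    rw [← integral_add (integrable_mul φ.memL2_deriv χ.memL2_deriv)
      (integrable_mul ψ.memL2_deriv χ.memL2_deriv)]
    apply integral_congr_ae
    filter_upwards [deriv_add_ae φ ψ] with t ht
    rw [ht, Pi.add_apply, add_mul]
  smul_left φ ψ c := by
    rw [← integral_const_mul]
    apply integral_congr_ae
    filter_upwards with t
    rw [coe_smul, deriv_smul_eq]
    simp [mul_assoc]
  definite φ h := by
    apply eq_zero_of_deriv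
    have := (integral_eq_zero_iff_of_nonneg (fun t => mul_self_nonneg _)
      (integrable_mul φ.memL2_deriv φ.memL2_deriv)).1 h
    filter_upwards [this] with t ht
    simpa using ht

instance : NormedAddCommGroup (H10 τ) := (core τ).toNormedAddCommGroup

instance : InnerProductSpace ℝ (H10 τ) := InnerProductSpace.ofCore (core τ).toCore

theorem inner_def (φ ψ : H10 τ) :
    inner ℝ φ ψ = ∫ t in Icc 0 τ, deriv φ t * deriv ψ t := rfl

theorem norm_sq (φ : H10 τ) : ‖φ‖ ^ 2 = ∫ t in Icc 0 τ, deriv φ t * deriv φ t := by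
  rw [← real_inner_self_eq_norm_sq, inner_def]

/-- Differentiation as an isometry from `H¹₀[0, τ]` into `L²[0, τ]`. -/
def derivL2 (τ : ℝ) : H10 τ →ₗᵢ[ℝ] Lp ℝ 2 (vol τ) where
  toFun φ := φ.memL2_deriv.toLp
  map_add' φ ψ := by
    rw [← MemLp.toLp_add]
    exact (MemLp.toLp_eq_toLp_iff _ _).2 (deriv_add_ae φ ψ)
  map_smul' c φ := by
    rw [RingHom.id_apply, ← MemLp.toLp_const_smul]
    apply (MemLp.toLp_eq_toLp_iff _ _).2
    rw [coe_smul, deriv_smul_eq]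
  norm_map' φ := by
    rw [← sq_eq_sq₀ (norm_nonneg _) (norm_nonneg _), norm_sq, ← real_inner_self_eq_norm_sq,
      L2.inner_def]
    apply integral_congr_ae
    filter_upwards [φ.memL2_deriv.coeFn_toLp] with t ht
    simp only [LinearMap.coe_mk, AddHom.coe_mk]
    rw [ht]
    simp [sq]

theorem exists_deriv_eq {g : ℝ → ℝ} (hg : MemLp g 2 (vol τ)) (h0 : ∫ t, g t ∂(vol τ) = 0) :
    ∃ φ : H10 τ, deriv φ =ᵐ[vol τ] g := by
  rcases lt_or_ge τ 0 with hτ | hτ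
  · refine ⟨0, ?_⟩
    have : vol τ = 0 := by simp [vol, Icc_eq_empty (not_le.2 hτ)]
    simp only [this, Filter.EventuallyEq, ae_zero, Filter.eventually_bot]
  have hint : IntervalIntegrable g volume 0 τ := by
    rw [intervalIntegrable_iff_integrableOn_Icc_of_le hτ]
    exact hg.integrable (by norm_num)
  set G : ℝ → ℝ := fun t => ∫ s in (0 : ℝ)..t, g s with hG
  set φ : ℝ → ℝ := (Icc 0 τ).indicator G with hφ
  have hGφ : ∀ t ∈ Icc 0 τ, φ t = G t := fun t ht => indicator_of_mem ht _
  have hac : AbsolutelyContinuousOnInterval G 0 τ :=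
    hint.absolutelyContinuousOnInterval_intervalIntegral (by simp)
  have hacφ : AbsolutelyContinuousOnInterval φ 0 τ := by
    rw [absolutelyContinuousOnInterval_iff] at hac ⊢
    intro ε hε
    obtain ⟨δ, hδ, h⟩ := hac ε hε
    refine ⟨δ, hδ, fun E hE hE2 => ?_⟩
    convert h E hE hE2 using 1
    apply Finset.sum_congr rfl
    intro i hi
    have := hE.1 i hi
    rw [uIcc_of_le hτ] at this
    rw [hGφ _ this.1, hGφ _ this.2]
  have hd : deriv φ =ᵐ[vol τ] g := by
    have h1 : ∀ᵐ t, t ∈ Icc 0 τ → HasDerivAt G (g t) t := by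
      filter_upwards [hint.ae_hasDerivAt_integral] with t ht h
      rw [uIcc_of_le hτ] at ht
      exact ht h 0 ⟨le_rfl, hτ⟩
    have h2 : ∀ᵐ t ∂(vol τ), t ∈ Ioo 0 τ := by
      rw [vol, ← Measure.restrict_congr_set (Ioo_ae_eq_Icc (a := (0 : ℝ)) (b := τ))]
      exact ae_restrict_mem measurableSet_Ioo
    rw [← ae_restrict_iff' measurableSet_Icc] at h1
    filter_upwards [h1, h2] with t ht1 ht2
    have : φ =ᶠ[nhds t] G := by
      filter_upwards [Ioo_mem_nhds ht2.1 ht2.2] with s hs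
      exact hGφ s (Ioo_subset_Icc_self hs)
    rw [this.deriv_eq]
    exact ht1.deriv
  refine ⟨⟨φ, ⟨hacφ, (memLp_congr_ae hd).2 hg⟩, ?_, ?_, fun t ht => indicator_of_notMem ht _⟩, hd⟩
  · rw [hGφ 0 ⟨le_rfl, hτ⟩]
    simp [hG]
  · rw [hGφ τ ⟨hτ, le_rfl⟩]
    simp only [hG]
    rw [intervalIntegral.integral_of_le hτ, ← integral_Icc_eq_integral_Ioc, h0]

theorem range_derivL2 :
    range (derivL2 τ) = {g : Lp ℝ 2 (vol τ) | inner ℝ ((memLp_const (1 : ℝ)).toLp) g = 0} := by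
  have key : ∀ g : Lp ℝ 2 (vol τ),
      inner ℝ ((memLp_const (1 : ℝ)).toLp) g = ∫ t, g t ∂(vol τ) := by
    intro g
    rw [L2.inner_def]
    apply integral_congr_ae
    filter_upwards [(memLp_const (μ := vol τ) (p := 2) (1 : ℝ)).coeFn_toLp] with t ht
    rw [ht]
    simp
  ext g
  rw [mem_ofPred_eq, key]
  constructor
  · rintro ⟨φ, rfl⟩
    rw [← φ.integral_deriv]
    exact integral_congr_ae φ.memL2_deriv.coeFn_toLp
  · intro h
    obtain ⟨φ, hφ⟩ := exists_deriv_eq (Lp.memLp g) h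
    exact ⟨φ, Lp.ext (φ.memL2_deriv.coeFn_toLp.trans hφ)⟩

instance : CompleteSpace (H10 τ) := by
  have hcl : IsClosed (range (derivL2 τ)) := by
    rw [range_derivL2]
    exact isClosed_eq (by fun_prop) continuous_const
  exact (derivL2 τ).isometry.isUniformInducing.completeSpace hcl.isComplete

theorem integral_abs_mul_le {f g : ℝ → ℝ} (hf : MemLp f 2 (vol τ)) (hg : MemLp g 2 (vol τ)) :
    ∫ t, |f t| * |g t| ∂(vol τ) ≤ √(∫ t, f t * f t ∂(vol τ)) * √(∫ t, g t * g t ∂(vol τ)) := by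
  have h := integral_mul_norm_le_Lp_mul_Lq (μ := vol τ) (f := f) (g := g) (p := 2) (q := 2)
    Real.HolderConjugate.two_two (by simpa using hf) (by simpa using hg)
  simp only [Real.norm_eq_abs, Real.rpow_two, sq_abs, ← Real.sqrt_eq_rpow] at h
  simpa only [← sq] using h

theorem integral_deriv_mul_le (φ : H10 τ) {g : ℝ → ℝ} (hg : MemLp g 2 (vol τ)) :
    ∫ t, |deriv φ t| * |g t| ∂(vol τ) ≤ √(∫ t, g t * g t ∂(vol τ)) * ‖φ‖ := by
  have h := integral_abs_mul_le φ.memL2_deriv hg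
  rwa [← norm_sq, Real.sqrt_sq (norm_nonneg _), mul_comm] at h

theorem abs_le (φ : H10 τ) (t : ℝ) : |φ t| ≤ √(∫ _, 1 * 1 ∂(vol τ)) * ‖φ‖ := by
  by_cases ht : t ∈ Icc 0 τ
  · refine le_trans ?_ (integral_deriv_mul_le φ (memLp_const (1 : ℝ)))
    have hi : Integrable (fun s => |deriv φ s|) (vol τ) :=
      (φ.memL2_deriv.integrable (by norm_num)).abs
    simp only [abs_one, mul_one]
    rw [φ.eq_integral ht, intervalIntegral.integral_of_le ht.1]
    refine (abs_integral_le_integral_abs).trans ?_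
    exact setIntegral_mono_set hi (Filter.Eventually.of_forall fun _ => abs_nonneg _)
      (Ioc_subset_Icc_self.trans (Icc_subset_Icc le_rfl ht.2)).eventuallyLE
  · have h0 : φ t = 0 := φ.2.2.2.2 t ht
    rw [h0, abs_zero]
    positivity

theorem memL2_self (φ : H10 τ) : MemLp (φ : ℝ → ℝ) 2 (vol τ) := by
  rcases lt_or_ge τ 0 with hτ | hτ
  · simp [vol, Icc_eq_empty (not_le.2 hτ)]
  · have hc : ContinuousOn (φ : ℝ → ℝ) (Icc 0 τ) := by
      have := φ.ac.continuousOn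
      rwa [uIcc_of_le hτ] at this
    exact MemLp.of_bound (hc.aestronglyMeasurable measurableSet_Icc) _
      (Filter.Eventually.of_forall fun t => φ.abs_le t)

end H10

/-! ### Synthesis operators -/

section Synthesis

variable {E : Type*} [NormedAddCommGroup E] [NormedSpace ℝ E] {τ : ℝ}

theorem integrable_smul {f : ℝ → E} {a : ℝ → ℝ} (ha : MemLp a 2 (vol τ)) (hf : MemL2 τ f) :
    Integrable (fun t => a t • f t) (vol τ) :=
  memLp_one_iff_integrable.1 (MemLp.smul (p := 2) (q := 2) (r := 1) hf ha)

/-- The synthesis operator `T φ = ∫₀^τ φ(t) f(t) dt` associated with `f ∈ L²([0, τ]; E)`. -/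
def synthesis (f : ℝ → E) (hf : MemL2 τ f) : H10 τ →L[ℝ] E :=
  LinearMap.mkContinuousOfExistsBound
    { toFun := fun φ => ∫ t in Icc 0 τ, φ t • f t
      map_add' := fun φ ψ => by
        rw [← integral_add (integrable_smul φ.memL2_self hf) (integrable_smul ψ.memL2_self hf)]
        simp only [H10.coe_add, Pi.add_apply, add_smul]
      map_smul' := fun c φ => by
        rw [RingHom.id_apply, ← integral_smul]
        simp only [H10.coe_smul, Pi.smul_apply, smul_eq_mul, mul_smul] }
    ⟨√(∫ _, 1 * 1 ∂(vol τ)) * ∫ t, ‖f t‖ ∂(vol τ), fun φ => by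
      have hi : Integrable (fun t => ‖f t‖) (vol τ) := (hf.integrable (by norm_num)).norm
      calc ‖∫ t in Icc 0 τ, φ t • f t‖ ≤ ∫ t in Icc 0 τ, ‖φ t • f t‖ :=
            norm_integral_le_integral_norm _
        _ ≤ ∫ t in Icc 0 τ, (√(∫ _, 1 * 1 ∂(vol τ)) * ‖φ‖) * ‖f t‖ := by
            refine integral_mono (integrable_smul φ.memL2_self hf).norm (hi.const_mul _) ?_
            intro t
            simp only [norm_smul, Real.norm_eq_abs]
            exact mul_le_mul_of_nonneg_right (φ.abs_le t) (norm_nonneg _)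
        _ = _ := by rw [integral_const_mul]; ring⟩

/-- The differentiated synthesis operator `T_d φ = -∫₀^τ φ'(t) f(t) dt` associated with
`f ∈ L²([0, τ]; E)`. -/
def dsynthesis (f : ℝ → E) (hf : MemL2 τ f) : H10 τ →L[ℝ] E :=
  LinearMap.mkContinuousOfExistsBound
    { toFun := fun φ => -∫ t in Icc 0 τ, deriv φ t • f t
      map_add' := fun φ ψ => by
        rw [← neg_add, ← integral_add (integrable_smul φ.memL2_deriv hf)
          (integrable_smul ψ.memL2_deriv hf)]
        congr 1
        apply integral_congr_ae
        filter_upwards [H10.deriv_add_ae φ ψ] with t ht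
        rw [ht, Pi.add_apply, add_smul]
      map_smul' := fun c φ => by
        rw [RingHom.id_apply, smul_neg, ← integral_smul]
        simp only [H10.coe_smul, deriv_smul_eq, Pi.smul_apply, smul_eq_mul, mul_smul] }
    ⟨√(∫ t, ‖f t‖ * ‖f t‖ ∂(vol τ)), fun φ => by
      calc ‖-∫ t in Icc 0 τ, deriv φ t • f t‖ ≤ ∫ t in Icc 0 τ, ‖deriv φ t • f t‖ := by
            rw [norm_neg]
            exact norm_integral_le_integral_norm _
        _ = ∫ t in Icc 0 τ, |deriv φ t| * |‖f t‖| := by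
            simp only [norm_smul, Real.norm_eq_abs, abs_norm]
        _ ≤ _ := φ.integral_deriv_mul_le (MemLp.norm hf)⟩

theorem synthesis_apply (f : ℝ → E) (hf : MemL2 τ f) (φ : H10 τ) :
    synthesis f hf φ = ∫ t in Icc 0 τ, φ t • f t := rfl

theorem dsynthesis_apply (f : ℝ → E) (hf : MemL2 τ f) (φ : H10 τ) :
    dsynthesis f hf φ = -∫ t in Icc 0 τ, deriv φ t • f t := rfl

/-- A function in `H¹([0, τ]; E)` is square integrable on `[0, τ]`. -/
theorem MemH1.memL2 {f : ℝ → E} (hf : MemH1 τ f) : MemL2 τ f := by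
  rcases lt_or_ge τ 0 with hτ | hτ
  · simp [MemL2, vol, Icc_eq_empty (not_le.2 hτ)]
  · have hc : ContinuousOn f (Icc 0 τ) := by
      have := hf.1.continuousOn
      rwa [uIcc_of_le hτ] at this
    obtain ⟨C, hC⟩ := isCompact_Icc.exists_bound_of_continuousOn hc
    exact MemLp.of_bound (hc.aestronglyMeasurable_of_isCompact isCompact_Icc measurableSet_Icc) C
      ((ae_restrict_iff' measurableSet_Icc).2 (Filter.Eventually.of_forall hC))

end Synthesis

/-- `ℝⁿ` with its Euclidean inner product. -/
abbrev Vec (n : ℕ) : Type := EuclideanSpace ℝ (Fin n)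

/-- The matrix of the operator `S T* : ℝⁿ → ℝᵐ`, for bounded operators `S : H¹₀[0, τ] → ℝᵐ` and
`T : H¹₀[0, τ] → ℝⁿ`, where `T*` is the Hilbert space adjoint. -/
def mulAdj {τ : ℝ} {m n : ℕ} (S : H10 τ →L[ℝ] Vec m) (T : H10 τ →L[ℝ] Vec n) :
    Matrix (Fin m) (Fin n) ℝ :=
  Matrix.toEuclideanLin.symm (S ∘L ContinuousLinearMap.adjoint T).toLinearMap

/-! ### Noisy data -/

/-- The noise class `Δ_c[0, τ] = {w ∈ L²([0, τ]; ℝⁿ) : W W* ⪯ c I}`, where `W` is the synthesis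
operator associated with `w`. -/
def noiseClass (n : ℕ) (τ c : ℝ) : Set (ℝ → Vec n) :=
  {w | ∃ hw : MemL2 τ w,
    (c • (1 : Matrix (Fin n) (Fin n) ℝ) - mulAdj (synthesis w hw) (synthesis w hw)).PosSemidef}

/-- The set of all systems `(A, B)` for which there is a noise `w ∈ Δ_c[0, τ]` with
`x' = A x + B u + w` a.e. on `[0, τ]`. -/
def compatible {n m : ℕ} (τ c : ℝ) (x : ℝ → Vec n) (u : ℝ → Vec m) :
    Set (Matrix (Fin n) (Fin n) ℝ × Matrix (Fin n) (Fin m) ℝ) :=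
  {S | ∃ w ∈ noiseClass n τ c, ∀ᵐ t ∂(vol τ),
    deriv x t = Matrix.toEuclideanLin S.1 (x t) + Matrix.toEuclideanLin S.2 (u t) + w t}

/-- Informativity for quadratic stabilization under the noise class `Δ_c[0, τ]`: there are `P ≻ 0`
and `K` with `(A + B K) P + P (A + B K)ᵀ ≺ 0` for all compatible systems `(A, B)`. -/
def InformativeQS {n m : ℕ} (τ c : ℝ) (x : ℝ → Vec n) (u : ℝ → Vec m) : Prop :=
  ∃ (P : Matrix (Fin n) (Fin n) ℝ) (K : Matrix (Fin m) (Fin n) ℝ), P.PosDef ∧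
    ∀ A B, (A, B) ∈ compatible τ c x u →
      (-((A + B * K) * P + P * (A + B * K).transpose)).PosDef

/-- A real square matrix is Hurwitz if all its complex eigenvalues have negative real part. -/
def Hurwitz {n : ℕ} (M : Matrix (Fin n) (Fin n) ℝ) : Prop :=
  ∀ z ∈ spectrum ℂ (M.map Complex.ofReal), z.re < 0

/-- The symmetric block matrix of size `n + (n + m)` that the linear matrix inequality requires to
be positive semidefinite; `Ξd`, `Ξ` and `Υ` are bounded operators on `H¹₀[0, τ]`. -/
def lmiMatrix {n m : ℕ} {τ : ℝ} (Ξd Ξ : H10 τ →L[ℝ] Vec n) (Υ : H10 τ →L[ℝ] Vec m) (c α : ℝ)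
    (P : Matrix (Fin n) (Fin n) ℝ) (L : Matrix (Fin m) (Fin n) ℝ) :
    Matrix (Fin n ⊕ (Fin n ⊕ Fin m)) (Fin n ⊕ (Fin n ⊕ Fin m)) ℝ :=
  Matrix.fromBlocks
    (α • mulAdj Ξd Ξd - (α * c + 1) • 1)
    (Matrix.fromCols (-P - α • mulAdj Ξd Ξ) (-L.transpose - α • mulAdj Ξd Υ))
    (Matrix.fromRows (-P - α • mulAdj Ξ Ξd) (-L - α • mulAdj Υ Ξd))
    (Matrix.fromBlocks
      (α • mulAdj Ξ Ξ) (α • mulAdj Ξ Υ)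
      (α • mulAdj Υ Ξ) (α • mulAdj Υ Υ))

end DataDriven

end

open DataDriven

/-! Integration by parts turns `x' = A x + B u + w` into `W = Ξd - A Ξ - B Υ`, so `W W* ⪯ c I` says
`‖Ξd* y - (Ξ* Aᵀ y + Υ* Bᵀ y)‖² ≤ c ‖y‖²` for all `y` (`mem_compatible_iff`). The matrix in (ii) is
the quadratic form `α (‖Ξd* y - (Ξ* p + Υ* q)‖² - c ‖y‖²) - 2 (p ⬝ P y + q ⬝ L y) - ‖y‖²` in free
vectors `y, p, q`. For a compatible system, `p = Aᵀ y`, `q = Bᵀ y` make the `α` term nonpositive,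
and what remains is the strict Lyapunov inequality with `L = K P`. This proves (ii) ⇒ (i) and the
Hurwitz claim.

The converse needs a multiplier `α`, which `exists_multiplier` supplies. Orthogonal projection onto
the range of `(p, q) ↦ Ξ* p + Υ* q` turns the compatible systems into a ball `‖Y y‖² ≤ s(y)` of
linear maps, and `petersen` treats that ball. Rank-one maps `Y` realize the worst case at each
single `y`; compactness gives a uniform margin; part of the margin is spent on enlarging the ball,
so that the S-lemma has a strictly feasible point even when `s` degenerates (for instance when `c =
0`). -/

namespace DataDriven

open LinearMap (BilinForm)

/-! ### The S-lemma -/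

/-- A concave quadratic polynomial that is positive at `0` has roots of both signs. -/
theorem exists_neg_pos_roots {a b d : ℝ} (ha : 0 < a) (hd : d < 0) :
    ∃ s t : ℝ, s < 0 ∧ 0 < t ∧ d * (s * t) = a ∧ a + s * b + s ^ 2 * d = 0 ∧
      a + t * b + t ^ 2 * d = 0 := by
  have hD : 0 ≤ b ^ 2 - 4 * a * d := by nlinarith [sq_nonneg b, mul_pos ha (neg_pos.2 hd)]
  set D := √(b ^ 2 - 4 * a * d) with hDdef
  have hDD : D ^ 2 = b ^ 2 - 4 * a * d := Real.sq_sqrt hD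
  have hbD : |b| < D := by
    rw [hDdef, ← Real.sqrt_sq_eq_abs]
    exact Real.sqrt_lt_sqrt (sq_nonneg b) (by nlinarith [mul_pos ha (neg_pos.2 hd)])
  obtain ⟨h1, h2⟩ := abs_lt.1 hbD
  have hd' : d ≠ 0 := hd.ne
  refine ⟨(-b + D) / (2 * d), (-b - D) / (2 * d), div_neg_of_pos_of_neg (by linarith)
    (by linarith), div_pos_of_neg_of_neg (by linarith) (by linarith), ?_, ?_, ?_⟩ <;>
  · field_simp
    linarith

/-- The S-lemma for a pair of homogeneous quadratic forms. -/
theorem s_lemma {V : Type*} [AddCommGroup V] [Module ℝ V] (f g : BilinForm ℝ V)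
    (h : ∀ z, 0 ≤ g z z → 0 ≤ f z z) (hpos : ∃ z, 0 < g z z) :
    ∃ a : ℝ, 0 ≤ a ∧ ∀ z, 0 ≤ f z z - a * g z z := by
  -- Every ratio `f / g` taken where `g < 0` is at most every ratio taken where `g > 0`. The line `z
  -- + r w` meets `g = 0` at parameters `s < 0 < t`, where `f ≥ 0`; weighting these two inequalities
  -- by `t` and `-s` cancels the mixed terms of `f`.
  have key : ∀ z w, 0 < g z z → g w w < 0 → g w w * f z z ≤ f w w * g z z := by
    intro z w hz hw
    obtain ⟨s, t, hs, ht, hst, h1, h2⟩ := exists_neg_pos_roots (b := g z w + g w z) hz hw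
    have expand : ∀ (q : BilinForm ℝ V) (r : ℝ),
        q (z + r • w) (z + r • w) = q z z + r * (q z w + q w z) + r ^ 2 * q w w := by
      intro q r
      simp only [map_add, map_smul, LinearMap.add_apply, LinearMap.smul_apply, smul_eq_mul]
      ring
    have f1 := h (z + s • w) (by rw [expand]; exact h1.ge)
    have f2 := h (z + t • w) (by rw [expand]; exact h2.ge)
    rw [expand] at f1 f2
    have h3 : 0 ≤ (t - s) * (f z z - s * t * f w w) := by
      nlinarith [mul_nonneg ht.le f1, mul_nonneg (neg_nonneg.2 hs.le) f2]
    have h4 : 0 ≤ f z z - s * t * f w w := nonneg_of_mul_nonneg_right h3 (by linarith)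
    rw [← hst]
    nlinarith [mul_nonneg (neg_nonneg.2 hw.le) h4]
  -- The multiplier is the infimum of `f / g` over `g > 0`; by `key` it dominates the ratios over `g
  -- < 0`.
  set R : Set ℝ := {r | ∃ z, 0 < g z z ∧ r = f z z / g z z} with hR
  have hne : R.Nonempty := by
    obtain ⟨z, hz⟩ := hpos
    exact ⟨_, z, hz, rfl⟩
  have hlb : ∀ r ∈ R, 0 ≤ r := by
    rintro r ⟨z, hz, rfl⟩
    exact div_nonneg (h z hz.le) hz.le
  refine ⟨sInf R, le_csInf hne hlb, fun z => ?_⟩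
  rcases lt_trichotomy (g z z) 0 with hz | hz | hz
  · have : f z z / g z z ≤ sInf R := by
      refine le_csInf hne ?_
      rintro r ⟨w, hw, rfl⟩
      rw [le_div_iff₀ hw, div_mul_eq_mul_div, div_le_iff_of_neg hz]
      have := key w z hw hz
      linarith
    rw [div_le_iff_of_neg hz] at this
    linarith
  · rw [hz, mul_zero, sub_zero]
    exact h z hz.ge
  · have : sInf R ≤ f z z / g z z := csInf_le ⟨0, hlb⟩ ⟨z, hz, rfl⟩
    rw [le_div_iff₀ hz] at this
    linarith

/-! ### Petersen's lemma -/

section Petersen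

variable {E U : Type*} [NormedAddCommGroup E] [InnerProductSpace ℝ E] [NormedAddCommGroup U]
  [InnerProductSpace ℝ U]

/-- A positive continuous function that is homogeneous of degree two is bounded below by a
multiple of the squared norm. -/
theorem exists_pos_mul_norm_sq_le [FiniteDimensional ℝ E] {h : E → ℝ} (hc : Continuous h)
    (hhom : ∀ (r : ℝ) (y : E), h (r • y) = r ^ 2 * h y) (hpos : ∀ y, y ≠ 0 → 0 < h y) :
    ∃ d : ℝ, 0 < d ∧ ∀ y, d * ‖y‖ ^ 2 ≤ h y := by
  have h0 : h 0 = 0 := by simpa using hhom 0 0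
  rcases subsingleton_or_nontrivial E with hE | hE
  · exact ⟨1, one_pos, fun y => by simp [Subsingleton.elim y 0, h0]⟩
  obtain ⟨y₀, hy₀, hmin⟩ := (isCompact_sphere (0 : E) 1).exists_isMinOn
    (NormedSpace.sphere_nonempty.2 zero_le_one) hc.continuousOn
  refine ⟨h y₀, hpos y₀ (ne_zero_of_mem_unit_sphere ⟨y₀, hy₀⟩), fun y => ?_⟩
  rcases eq_or_ne y 0 with rfl | hy
  · simp [h0]
  have hn : ‖y‖ ≠ 0 := norm_ne_zero_iff.2 hy
  have hm : h y₀ ≤ h (‖y‖⁻¹ • y) := hmin (by simp [norm_smul, hn])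
  calc h y₀ * ‖y‖ ^ 2 ≤ h (‖y‖⁻¹ • y) * ‖y‖ ^ 2 := by gcongr
    _ = h y := by rw [hhom]; field_simp

/-- A vector `u` with `‖u‖² ≤ s(y)` is the value at `y` of a linear map `Y` with `‖Y ·‖² ≤ s`. -/
theorem exists_linearMap_of_norm_sq_le (s : BilinForm ℝ E) (hs : ∀ y, 0 ≤ s y y)
    (hsymm : s.IsSymm) {y : E} {u : U} (hy : ‖u‖ ^ 2 ≤ s y y) :
    ∃ Y : E →ₗ[ℝ] U, Y y = u ∧ ∀ z, ‖Y z‖ ^ 2 ≤ s z z := by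
  -- The rank-one map `z ↦ (s(y, z) / s(y, y)) u`, bounded by Cauchy–Schwarz for `s`. If `s(y, y) =
  -- 0`, then `u = 0` and the convention `0⁻¹ = 0` makes the map zero.
  refine ⟨((s y y)⁻¹ • s y).smulRight u, ?_, fun z => ?_⟩
  · rcases (hs y).eq_or_lt with h0 | h0
    · rw [← h0] at hy
      have : u = 0 := norm_eq_zero.1 (pow_eq_zero_iff two_ne_zero |>.1 (le_antisymm hy (sq_nonneg _)))
      simp [this]
    · simp [h0.ne']
  · have hcs := LinearMap.BilinForm.apply_sq_le_of_symm s hs (LinearMap.BilinForm.isSymm_iff.1 hsymm) y z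
    rcases (hs y).eq_or_lt with h0 | h0
    · simpa [← h0] using hs z
    · simp only [LinearMap.smulRight_apply, LinearMap.smul_apply, smul_eq_mul, norm_smul, mul_pow,
        Real.norm_eq_abs, sq_abs]
      calc ((s y y)⁻¹ ^ 2 * s y z ^ 2) * ‖u‖ ^ 2
          ≤ ((s y y)⁻¹ ^ 2 * (s y y * s z z)) * s y y := by
            have := hs z
            gcongr
        _ = s z z := by field_simp

/-- Petersen's lemma: the inequality `m(y) - 2⟪T y, Y y⟫ > 0` for all `Y` with `‖Y ·‖² ≤ s` is
certified by a multiplier. -/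
theorem petersen [FiniteDimensional ℝ E] (m s : BilinForm ℝ E) (T : E →ₗ[ℝ] U)
    (hs : ∀ y, 0 ≤ s y y) (hsymm : s.IsSymm)
    (h : ∀ Y : E →ₗ[ℝ] U, (∀ y, ‖Y y‖ ^ 2 ≤ s y y) →
      ∀ y, y ≠ 0 → 0 < m y y - 2 * inner ℝ (T y) (Y y)) :
    ∃ a b : ℝ, 0 ≤ a ∧ 0 < b ∧ ∀ y u,
      0 ≤ m y y - 2 * inner ℝ (T y) u - a * (s y y - ‖u‖ ^ 2) - b * ‖y‖ ^ 2 := by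
  rcases subsingleton_or_nontrivial E with hE | hE
  · refine ⟨1, 1, zero_le_one, one_pos, fun y u => ?_⟩
    rw [Subsingleton.elim y 0]
    simp
  have hcont : ∀ q : BilinForm ℝ E, Continuous fun y => q y y := by
    intro q
    let q' : E →L[ℝ] E →L[ℝ] ℝ :=
      LinearMap.toContinuousLinearMap (LinearMap.toContinuousLinearMap.toLinearMap ∘ₗ q)
    exact q'.continuous.clm_apply continuous_id
  have hT : Continuous T := T.continuous_of_finiteDimensional
  -- For fixed `y` the worst `Y` points along `T y` with `‖Y y‖² = s(y)`, which costs `2 √s(y) ‖T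
  -- y‖`. The remaining gap is continuous, positive off zero and homogeneous of degree two.
  obtain ⟨d, hd, hbound⟩ : ∃ d : ℝ, 0 < d ∧ ∀ y, d * ‖y‖ ^ 2 ≤ m y y - 2 * (√(s y y) * ‖T y‖) := by
    apply exists_pos_mul_norm_sq_le
    · exact (hcont m).sub ((((hcont s).sqrt).mul hT.norm).const_mul 2)
    · intro r y
      have e : r * (r * s y y) = r ^ 2 * s y y := by ring
      simp only [map_smul, LinearMap.smul_apply, smul_eq_mul, norm_smul, Real.norm_eq_abs]
      rw [e, Real.sqrt_mul (sq_nonneg r), Real.sqrt_sq_eq_abs]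
      linear_combination (-2 * (√(s y y) * ‖T y‖)) * abs_mul_abs_self r
    · intro y hy
      rcases eq_or_ne (T y) 0 with h0 | h0
      · simpa [h0] using h 0 (by simpa using hs) y hy
      have hn : ‖T y‖ ≠ 0 := norm_ne_zero_iff.2 h0
      obtain ⟨Y, hYy, hY⟩ := exists_linearMap_of_norm_sq_le s hs hsymm (y := y)
        (u := (√(s y y) * ‖T y‖⁻¹) • T y) (by
          rw [norm_smul, norm_mul, norm_inv, norm_norm, mul_assoc, inv_mul_cancel₀ hn, mul_one,
            Real.norm_eq_abs, sq_abs, Real.sq_sqrt (hs y)])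
      have := h Y hY y hy
      rw [hYy, inner_smul_right, real_inner_self_eq_norm_sq] at this
      convert this using 3
      field_simp
  set C := ‖LinearMap.toContinuousLinearMap T‖ with hC
  have hTC : ∀ y, ‖T y‖ ≤ C * ‖y‖ := fun y => (LinearMap.toContinuousLinearMap T).le_opNorm y
  have hC0 : 0 ≤ C := norm_nonneg _
  -- Enlarging the radius from `√s(y)` to at most `√s(y) + e ‖y‖` costs at most `2 e C ‖y‖² ≤ (d /
  -- 2) ‖y‖²`, half of the margin. The `+ 1` covers `T = 0`.
  set e := d / (4 * (C + 1)) with he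
  have he0 : 0 < e := by positivity
  have heC : e * C ≤ d / 4 := by
    rw [he, div_mul_eq_mul_div, div_le_div_iff₀ (by positivity) (by norm_num)]
    nlinarith
  have hfg : ∀ y u, ‖u‖ ^ 2 ≤ s y y + e ^ 2 * ‖y‖ ^ 2 →
      d / 2 * ‖y‖ ^ 2 ≤ m y y - 2 * inner ℝ (T y) u := by
    intro y u hu
    have hsq := Real.sq_sqrt (hs y)
    have hu' : ‖u‖ ≤ √(s y y) + e * ‖y‖ := by
      apply abs_le_of_sq_le_sq' _ (by positivity) |>.2
      nlinarith [mul_nonneg (Real.sqrt_nonneg (s y y)) (mul_nonneg he0.le (norm_nonneg y))]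
    have hin : inner ℝ (T y) u ≤ √(s y y) * ‖T y‖ + d / 4 * ‖y‖ ^ 2 :=
      calc inner ℝ (T y) u ≤ ‖T y‖ * ‖u‖ := real_inner_le_norm _ _
        _ ≤ ‖T y‖ * (√(s y y) + e * ‖y‖) := by gcongr
        _ = √(s y y) * ‖T y‖ + ‖T y‖ * (e * ‖y‖) := by ring
        _ ≤ √(s y y) * ‖T y‖ + (C * ‖y‖) * (e * ‖y‖) := by gcongr; exact hTC y
        _ = √(s y y) * ‖T y‖ + e * C * ‖y‖ ^ 2 := by ring
        _ ≤ _ := by gcongr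
    linarith [hbound y]
  set F : BilinForm ℝ (E × U) :=
    m.compl₁₂ (LinearMap.fst ℝ E U) (LinearMap.fst ℝ E U)
      - (2 : ℝ) • (innerₗ U).compl₁₂ (T ∘ₗ LinearMap.fst ℝ E U) (LinearMap.snd ℝ E U)
      - (d / 2) • (innerₗ E).compl₁₂ (LinearMap.fst ℝ E U) (LinearMap.fst ℝ E U) with hF
  set G : BilinForm ℝ (E × U) :=
    s.compl₁₂ (LinearMap.fst ℝ E U) (LinearMap.fst ℝ E U)
      + (e ^ 2) • (innerₗ E).compl₁₂ (LinearMap.fst ℝ E U) (LinearMap.fst ℝ E U)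
      - (innerₗ U).compl₁₂ (LinearMap.snd ℝ E U) (LinearMap.snd ℝ E U) with hG
  have hFa : ∀ z, F z z = m z.1 z.1 - 2 * inner ℝ (T z.1) z.2 - d / 2 * ‖z.1‖ ^ 2 := by
    intro z
    simp [hF]
  have hGa : ∀ z, G z z = s z.1 z.1 + e ^ 2 * ‖z.1‖ ^ 2 - ‖z.2‖ ^ 2 := by
    intro z
    simp [hG]
  -- The term `e² ‖y‖²` makes `G` positive at `(y, 0)` for any `y ≠ 0`, even if `s` vanishes.
  -- Afterwards it can be dropped, since `a e² ‖y‖² ≥ 0`.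
  obtain ⟨a, ha, hmul⟩ := s_lemma F G
    (fun z hz => by
      rw [hGa] at hz
      rw [hFa]
      linarith [hfg z.1 z.2 (by linarith)])
    (by
      obtain ⟨y, hy⟩ := exists_ne (0 : E)
      refine ⟨(y, 0), ?_⟩
      rw [hGa]
      have h1 := norm_pos_iff.2 hy
      have h2 : 0 < e ^ 2 * ‖y‖ ^ 2 := by positivity
      have h3 := hs y
      simp only [norm_zero]
      linarith)
  refine ⟨a, d / 2, ha, by positivity, fun y u => ?_⟩
  have := hmul (y, u)
  rw [hFa, hGa] at this
  have h1 : 0 ≤ a * (e ^ 2 * ‖y‖ ^ 2) := by positivity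
  simp only at this
  nlinarith

end Petersen

/-! ### From an operator constraint to a ball of linear maps -/

/-- If the linear maps `Z` with `‖X y - Q (Z y)‖² ≤ c ‖y‖²` exist and all make `B y (Z y)` negative
definite, then a multiplier certifies this. -/
theorem exists_multiplier {E F H : Type*} [NormedAddCommGroup E] [InnerProductSpace ℝ E]
    [FiniteDimensional ℝ E] [AddCommGroup F] [Module ℝ F] [FiniteDimensional ℝ F]
    [NormedAddCommGroup H] [InnerProductSpace ℝ H] (X : E →ₗ[ℝ] H) (Q : F →ₗ[ℝ] H)
    (B : E →ₗ[ℝ] F →ₗ[ℝ] ℝ) (c : ℝ)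
    (hne : ∃ Z : E →ₗ[ℝ] F, ∀ y, ‖X y - Q (Z y)‖ ^ 2 ≤ c * ‖y‖ ^ 2)
    (h : ∀ Z : E →ₗ[ℝ] F, (∀ y, ‖X y - Q (Z y)‖ ^ 2 ≤ c * ‖y‖ ^ 2) →
      ∀ y, y ≠ 0 → B y (Z y) < 0) :
    ∃ a b : ℝ, 0 ≤ a ∧ 0 < b ∧ ∀ y v,
      0 ≤ a * (‖X y - Q v‖ ^ 2 - c * ‖y‖ ^ 2) - 2 * B y v - b * ‖y‖ ^ 2 := by
  obtain ⟨Z₁, hZ₁⟩ := hne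
  -- Adding `z ↦ ⟪y, z⟫ r v` to `Z₁` is invisible to `Q`. If `B y v ≠ 0`, the chosen `r` makes `B y
  -- (Z y) = 0`, against strict negativity.
  have hker : ∀ y v, Q v = 0 → B y v = 0 := by
    intro y v hv
    by_contra hB
    have hy : y ≠ 0 := by
      rintro rfl
      simp at hB
    have hn : ‖y‖ ≠ 0 := norm_ne_zero_iff.2 hy
    set r : ℝ := -B y (Z₁ y) / (‖y‖ ^ 2 * B y v) with hr
    have := h (Z₁ + ((innerₗ E y).smulRight (r • v))) (fun z => by simpa [hv] using hZ₁ z) y hy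
    simp only [LinearMap.add_apply, LinearMap.smulRight_apply, innerₗ_apply_apply,
      real_inner_self_eq_norm_sq, map_add, map_smul, smul_eq_mul] at this
    have e : ‖y‖ ^ 2 * (r * B y v) = -B y (Z₁ y) := by
      rw [hr]
      field_simp
    linarith
  obtain ⟨σ, hσ⟩ := Q.rangeRestrict.exists_rightInverse_of_surjective Q.range_rangeRestrict
  have hσ' : ∀ u : Q.range, Q (σ u) = u := fun u =>
    congrArg Subtype.val (LinearMap.congr_fun hσ u)
  have hBσ : ∀ y v, B y (σ (Q.rangeRestrict v)) = B y v := by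
    intro y v
    have := hker y (σ (Q.rangeRestrict v) - v) (by rw [map_sub, hσ']; simp)
    rwa [map_sub, sub_eq_zero] at this
  -- By `hker`, `B y` factors through the range of `Q`; `T y` is the Riesz representative of the
  -- resulting functional.
  set T : E →ₗ[ℝ] Q.range :=
    (InnerProductSpace.toDual ℝ Q.range).symm.toLinearEquiv.toLinearMap ∘ₗ
      LinearMap.toContinuousLinearMap.toLinearMap ∘ₗ B.compl₂ σ with hT
  have hTi : ∀ y u, inner ℝ (T y) u = B y (σ u) := by
    intro y u
    simp [hT]
  set p : E →ₗ[ℝ] Q.range := Q.range.orthogonalProjectionOnto.toLinearMap ∘ₗ X with hp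
  set e : E →ₗ[ℝ] H := X - Q.range.subtype ∘ₗ p with he
  have hpyth : ∀ y v, ‖X y - Q v‖ ^ 2 = ‖e y‖ ^ 2 + ‖Q.rangeRestrict v - p y‖ ^ 2 := by
    intro y v
    have horth : inner ℝ (e y) ((Q.rangeRestrict v - p y : Q.range) : H) = 0 := by
      have := Q.range.sub_starProjection_mem_orthogonal (X y)
      exact Submodule.inner_left_of_mem_orthogonal (Q.rangeRestrict v - p y).2 this
    have hd : X y - Q v = e y - ((Q.rangeRestrict v - p y : Q.range) : H) := by
      simp [he]
    rw [hd, norm_sub_sq_real, horth]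
    simp
  -- By `hpyth`, the constraint on `Z` reads `‖Y y‖² ≤ s(y)` with `Y = Q Z - p`. Feasibility of `Z₁`
  -- makes `s` nonnegative.
  set s : BilinForm ℝ E := c • innerₗ E - (innerₗ H).compl₁₂ e e with hs
  have hsa : ∀ y, s y y = c * ‖y‖ ^ 2 - ‖e y‖ ^ 2 := by
    intro y
    simp [hs]
  set m : BilinForm ℝ E := (-2 : ℝ) • (innerₗ Q.range).compl₁₂ T p with hm
  have hma : ∀ y, m y y = -2 * inner ℝ (T y) (p y) := by
    intro y
    simp [hm]
  obtain ⟨a, b, ha, hb, hab⟩ := petersen m s T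
    (fun y => by
      have := hZ₁ y
      rw [hpyth] at this
      rw [hsa]
      linarith [sq_nonneg ‖Q.rangeRestrict (Z₁ y) - p y‖])
    ⟨fun y z => by simp [hs, real_inner_comm]⟩
    -- Each admissible `Y` lifts to the admissible `Z = σ (Y + p)`, for which `Q Z - p = Y`.
    (fun Y hY y hy => by
      have := h (σ ∘ₗ (Y + p)) (fun z => by
        have h1 := hY z
        rw [hsa] at h1
        have h2 : Q.rangeRestrict ((σ ∘ₗ (Y + p)) z) - p z = Y z := by
          have := LinearMap.congr_fun hσ ((Y + p) z)
          simp only [LinearMap.comp_apply, LinearMap.id_apply] at this ⊢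
          rw [this, LinearMap.add_apply, add_sub_cancel_right]
        rw [hpyth, h2]
        linarith) y hy
      rw [LinearMap.comp_apply, ← hTi, LinearMap.add_apply, inner_add_right] at this
      rw [hma]
      linarith)
  refine ⟨a, b, ha, hb, fun y v => ?_⟩
  have := hab y (Q.rangeRestrict v - p y)
  rw [hma, hsa, inner_sub_right, hTi y (Q.rangeRestrict v), hBσ] at this
  rw [hpyth]
  linarith

open scoped Matrix InnerProductSpace
open ContinuousLinearMap (adjoint)

/-! ### Synthesis operators and compatible systems -/

section Operators

variable {τ : ℝ} {n m : ℕ}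

/-- Through this identity every matrix inequality becomes one between norms and inner products of
adjoints in `H10 τ`. -/
theorem dotProduct_mulAdj_mulVec (S : H10 τ →L[ℝ] Vec m) (T : H10 τ →L[ℝ] Vec n)
    (v : Fin m → ℝ) (w : Fin n → ℝ) :
    v ⬝ᵥ (mulAdj S T *ᵥ w) =
      ⟪adjoint S (WithLp.toLp 2 v), adjoint T (WithLp.toLp 2 w)⟫_ℝ := by
  rw [ContinuousLinearMap.adjoint_inner_left]
  have h : S (adjoint T (WithLp.toLp 2 w)) = WithLp.toLp 2 (mulAdj S T *ᵥ w) := by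
    change _ = Matrix.toEuclideanLin (mulAdj S T) (WithLp.toLp 2 w)
    rw [mulAdj, LinearEquiv.apply_symm_apply]
    rfl
  rw [h, EuclideanSpace.inner_toLp_toLp, dotProduct_comm]
  simp

theorem transpose_mulAdj (S : H10 τ →L[ℝ] Vec m) (T : H10 τ →L[ℝ] Vec n) :
    (mulAdj S T)ᵀ = mulAdj T S := by
  ext i j
  have h1 := dotProduct_mulAdj_mulVec S T (Pi.single j 1) (Pi.single i 1)
  have h2 := dotProduct_mulAdj_mulVec T S (Pi.single i 1) (Pi.single j 1)
  rw [real_inner_comm, ← h1] at h2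
  simpa using h2.symm

theorem norm_toLp_sq (v : Fin n → ℝ) : ‖WithLp.toLp 2 v‖ ^ 2 = v ⬝ᵥ v := by
  rw [← real_inner_self_eq_norm_sq, EuclideanSpace.inner_toLp_toLp]
  simp

theorem posSemidef_sub_mulAdj_self_iff (c : ℝ) (W : H10 τ →L[ℝ] Vec n) :
    (c • (1 : Matrix (Fin n) (Fin n) ℝ) - mulAdj W W).PosSemidef ↔
      ∀ y, ‖adjoint W y‖ ^ 2 ≤ c * ‖y‖ ^ 2 := by
  have hH : (c • (1 : Matrix (Fin n) (Fin n) ℝ) - mulAdj W W).IsHermitian := by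
    simp [Matrix.IsHermitian, Matrix.conjTranspose_eq_transpose_of_trivial, transpose_mulAdj]
  have hq : ∀ v : Fin n → ℝ,
      star v ⬝ᵥ ((c • (1 : Matrix (Fin n) (Fin n) ℝ) - mulAdj W W) *ᵥ v) =
        c * ‖WithLp.toLp 2 v‖ ^ 2 - ‖adjoint W (WithLp.toLp 2 v)‖ ^ 2 := by
    intro v
    rw [star_trivial, Matrix.sub_mulVec, dotProduct_sub, dotProduct_mulAdj_mulVec,
      real_inner_self_eq_norm_sq, Matrix.smul_mulVec, Matrix.one_mulVec, dotProduct_smul,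
      norm_toLp_sq, smul_eq_mul]
  rw [Matrix.posSemidef_iff_dotProduct_mulVec, and_iff_right hH]
  refine ⟨fun h y => ?_, fun h v => ?_⟩
  · have := h y.ofLp
    rw [hq] at this
    simpa using this
  · rw [hq]
    linarith [h (WithLp.toLp 2 v)]

theorem integral_apply {f : ℝ → Vec n} (hf : Integrable f (vol τ)) (i : Fin n) :
    (∫ t, f t ∂(vol τ)) i = ∫ t, f t i ∂(vol τ) :=
  ((EuclideanSpace.proj (𝕜 := ℝ) i).integral_comp_comm hf).symm

theorem ac_apply {f : ℝ → Vec n} (hf : AbsolutelyContinuousOnInterval f 0 τ) (i : Fin n) :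
    AbsolutelyContinuousOnInterval (fun t => f t i) 0 τ := by
  rw [absolutelyContinuousOnInterval_iff] at hf ⊢
  intro ε hε
  obtain ⟨δ, hδ, h⟩ := hf ε hε
  refine ⟨δ, hδ, fun I hI hI2 => (Finset.sum_le_sum fun j _ => ?_).trans_lt (h I hI hI2)⟩
  rw [dist_eq_norm, dist_eq_norm]
  exact PiLp.norm_apply_le (f (I.2 j).1 - f (I.2 j).2) i

theorem deriv_apply_ae {f : ℝ → Vec n} (hf : AbsolutelyContinuousOnInterval f 0 τ) :
    ∀ᵐ t ∂(vol τ), ∀ i, deriv (fun s => f s i) t = deriv f t i := by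
  have h : ∀ᵐ t ∂(vol τ), ∀ i, DifferentiableAt ℝ (fun s => f s i) t :=
    ae_all_iff.2 fun i => ae_differentiableAt_of_ac (ac_apply hf i)
  filter_upwards [h] with t ht i
  have hd : DifferentiableAt ℝ f t := (differentiableAt_piLp 2).2 ht
  exact ((EuclideanSpace.proj (𝕜 := ℝ) i).hasFDerivAt.comp_hasDerivAt t hd.hasDerivAt).deriv

/-- Integration by parts: the differentiated synthesis operator of `x ∈ H¹` is the synthesis
operator of `x'`. -/
theorem dsynthesis_eq_synthesis_deriv (hτ : 0 ≤ τ) {x : ℝ → Vec n} (hx : MemH1 τ x) :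
    dsynthesis x hx.memL2 = synthesis (deriv x) hx.2 := by
  ext φ i
  rw [dsynthesis_apply, synthesis_apply, PiLp.neg_apply,
    integral_apply (integrable_smul φ.memL2_deriv hx.memL2),
    integral_apply (integrable_smul φ.memL2_self hx.2)]
  simp only [PiLp.smul_apply, smul_eq_mul]
  have h1 : ∫ t, φ t * deriv x t i ∂(vol τ) = ∫ t, φ t * deriv (fun s => x s i) t ∂(vol τ) := by
    apply integral_congr_ae
    filter_upwards [deriv_apply_ae hx.1] with t ht
    rw [ht i]
  -- The boundary terms vanish because `φ 0 = φ τ = 0`.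
  have h2 := φ.ac.integral_mul_deriv_eq_deriv_mul (ac_apply hx.1 i)
  rw [φ.2.2.1, φ.2.2.2.1, intervalIntegral.integral_of_le hτ, intervalIntegral.integral_of_le hτ,
    ← integral_Icc_eq_integral_Ioc, ← integral_Icc_eq_integral_Ioc] at h2
  rw [h1, h2]
  ring

/-- The noise of a system, as seen by the synthesis operators. -/
theorem synthesis_noise (hτ : 0 ≤ τ) {x : ℝ → Vec n} (hx : MemH1 τ x) {u : ℝ → Vec m}
    (hu : MemL2 τ u) {w : ℝ → Vec n} (hw : MemL2 τ w) (A : Matrix (Fin n) (Fin n) ℝ)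
    (B : Matrix (Fin n) (Fin m) ℝ)
    (h : ∀ᵐ t ∂(vol τ),
      deriv x t = Matrix.toEuclideanLin A (x t) + Matrix.toEuclideanLin B (u t) + w t) (φ : H10 τ) :
    synthesis w hw φ = dsynthesis x hx.memL2 φ
      - Matrix.toEuclideanLin A (synthesis x hx.memL2 φ)
      - Matrix.toEuclideanLin B (synthesis u hu φ) := by
  have comm : ∀ {k : ℕ} (M : Matrix (Fin n) (Fin k) ℝ) {f : ℝ → Vec k} (hf : MemL2 τ f),
      Integrable (fun t => φ t • Matrix.toEuclideanLin M (f t)) (vol τ) ∧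
      Matrix.toEuclideanLin M (synthesis f hf φ) =
        ∫ t, φ t • Matrix.toEuclideanLin M (f t) ∂(vol τ) := by
    intro k M f hf
    have hi := integrable_smul φ.memL2_self hf
    have e : ∀ t, φ t • Matrix.toEuclideanLin M (f t) =
        LinearMap.toContinuousLinearMap (Matrix.toEuclideanLin M) (φ t • f t) := fun t => by
      rw [LinearMap.coe_toContinuousLinearMap', map_smul]
    simp only [e]
    exact ⟨ContinuousLinearMap.integrable_comp _ hi,
      (ContinuousLinearMap.integral_comp_comm
        (LinearMap.toContinuousLinearMap (Matrix.toEuclideanLin M)) hi).symm⟩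
  obtain ⟨hA, eA⟩ := comm A hx.memL2
  obtain ⟨hB, eB⟩ := comm B hu
  have hd := integrable_smul φ.memL2_self hx.2
  rw [dsynthesis_eq_synthesis_deriv hτ hx, eA, eB, synthesis_apply, synthesis_apply,
    ← integral_sub hd hA]
  refine Eq.trans ?_ (integral_sub (hd.sub hA) hB)
  apply integral_congr_ae
  filter_upwards [h] with t ht
  simp only [ht, smul_add]
  abel

theorem inner_toEuclideanLin_right {k l : ℕ} (M : Matrix (Fin k) (Fin l) ℝ) (a : Vec k)
    (b : Vec l) :
    ⟪a, Matrix.toEuclideanLin M b⟫_ℝ = ⟪Matrix.toEuclideanLin Mᵀ a, b⟫_ℝ := by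
  rw [← Matrix.conjTranspose_eq_transpose_of_trivial,
    Matrix.toEuclideanLin_conjTranspose_eq_adjoint, LinearMap.adjoint_inner_left]

theorem adjoint_synthesis_noise (hτ : 0 ≤ τ) {x : ℝ → Vec n} (hx : MemH1 τ x) {u : ℝ → Vec m}
    (hu : MemL2 τ u) {w : ℝ → Vec n} (hw : MemL2 τ w) (A : Matrix (Fin n) (Fin n) ℝ)
    (B : Matrix (Fin n) (Fin m) ℝ)
    (h : ∀ᵐ t ∂(vol τ),
      deriv x t = Matrix.toEuclideanLin A (x t) + Matrix.toEuclideanLin B (u t) + w t) (y : Vec n) :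
    adjoint (synthesis w hw) y = adjoint (dsynthesis x hx.memL2) y
      - (adjoint (synthesis x hx.memL2) (Matrix.toEuclideanLin Aᵀ y)
        + adjoint (synthesis u hu) (Matrix.toEuclideanLin Bᵀ y)) := by
  refine ext_inner_right ℝ fun φ => ?_
  simp only [inner_sub_left, inner_add_left, ContinuousLinearMap.adjoint_inner_left]
  rw [synthesis_noise hτ hx hu hw A B h, inner_sub_right, inner_sub_right,
    inner_toEuclideanLin_right, inner_toEuclideanLin_right, sub_sub]

/-- The compatible systems are the solutions of a quadratic matrix inequality. -/
theorem mem_compatible_iff (hτ : 0 ≤ τ) (c : ℝ) {x : ℝ → Vec n} (hx : MemH1 τ x) {u : ℝ → Vec m}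
    (hu : MemL2 τ u) (A : Matrix (Fin n) (Fin n) ℝ) (B : Matrix (Fin n) (Fin m) ℝ) :
    (A, B) ∈ compatible τ c x u ↔ ∀ y, ‖adjoint (dsynthesis x hx.memL2) y
      - (adjoint (synthesis x hx.memL2) (Matrix.toEuclideanLin Aᵀ y)
        + adjoint (synthesis u hu) (Matrix.toEuclideanLin Bᵀ y))‖ ^ 2 ≤ c * ‖y‖ ^ 2 := by
  constructor
  · rintro ⟨w, ⟨hw, hW⟩, h⟩ y
    rw [← adjoint_synthesis_noise hτ hx hu hw A B h]
    exact (posSemidef_sub_mulAdj_self_iff c _).1 hW y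
  · intro h
    -- The noise is forced to be the residual of the equation. It lies in `L²`, and the assumed
    -- bound is precisely its membership in the noise class.
    set w : ℝ → Vec n := fun t =>
      deriv x t - Matrix.toEuclideanLin A (x t) - Matrix.toEuclideanLin B (u t) with hwdef
    have hw : MemL2 τ w :=
      (hx.2.sub ((LinearMap.toContinuousLinearMap (Matrix.toEuclideanLin A)).comp_memLp' hx.memL2)).sub
        ((LinearMap.toContinuousLinearMap (Matrix.toEuclideanLin B)).comp_memLp' hu)
    have hd : ∀ᵐ t ∂(vol τ),
        deriv x t = Matrix.toEuclideanLin A (x t) + Matrix.toEuclideanLin B (u t) + w t :=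
      Filter.Eventually.of_forall fun t => by
        simp only [hwdef]
        abel
    refine ⟨w, ⟨hw, (posSemidef_sub_mulAdj_self_iff c _).2 fun y => ?_⟩, hd⟩
    rw [adjoint_synthesis_noise hτ hx hu hw A B hd]
    exact h y

end Operators

/-! ### Quadratic forms of the matrix inequalities; Lyapunov's criterion -/

section Matrices

variable {τ : ℝ} {n m : ℕ}

theorem lmiMatrix_isHermitian (Ξd Ξ : H10 τ →L[ℝ] Vec n) (Υ : H10 τ →L[ℝ] Vec m) (c α : ℝ)
    {P : Matrix (Fin n) (Fin n) ℝ} (hP : Pᵀ = P) (L : Matrix (Fin m) (Fin n) ℝ) :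
    (lmiMatrix Ξd Ξ Υ c α P L).IsHermitian := by
  simp [Matrix.IsHermitian, Matrix.conjTranspose_eq_transpose_of_trivial, lmiMatrix,
    Matrix.fromBlocks_transpose, Matrix.transpose_fromCols, Matrix.transpose_fromRows,
    transpose_mulAdj, hP]

/-- The quadratic form of the matrix of the linear matrix inequality. -/
theorem dotProduct_lmiMatrix_mulVec (Ξd Ξ : H10 τ →L[ℝ] Vec n) (Υ : H10 τ →L[ℝ] Vec m) (c α : ℝ)
    {P : Matrix (Fin n) (Fin n) ℝ} (hP : Pᵀ = P) (L : Matrix (Fin m) (Fin n) ℝ)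
    (a b : Fin n → ℝ) (d : Fin m → ℝ) :
    Sum.elim a (Sum.elim b d) ⬝ᵥ (lmiMatrix Ξd Ξ Υ c α P L *ᵥ Sum.elim a (Sum.elim b d)) =
      α * (‖adjoint Ξd (WithLp.toLp 2 a)
          - (adjoint Ξ (WithLp.toLp 2 b) + adjoint Υ (WithLp.toLp 2 d))‖ ^ 2
        - c * ‖WithLp.toLp 2 a‖ ^ 2)
      - 2 * (b ⬝ᵥ (P *ᵥ a) + d ⬝ᵥ (L *ᵥ a)) - ‖WithLp.toLp 2 a‖ ^ 2 := by
  have h1 : a ⬝ᵥ (P *ᵥ b) = b ⬝ᵥ (P *ᵥ a) := by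
    rw [← Matrix.dotProduct_transpose_mulVec, hP]
  have h2 : a ⬝ᵥ (Lᵀ *ᵥ d) = d ⬝ᵥ (L *ᵥ a) := Matrix.dotProduct_transpose_mulVec _ _ _
  simp only [lmiMatrix, Matrix.fromBlocks_mulVec, Sum.elim_comp_inl, Sum.elim_comp_inr,
    Matrix.fromCols_mulVec_sumElim, Matrix.fromRows_mulVec, sumElim_dotProduct_sumElim,
    Matrix.sub_mulVec, Matrix.neg_mulVec, Matrix.smul_mulVec, Matrix.one_mulVec,
    dotProduct_add, dotProduct_sub, dotProduct_neg, dotProduct_smul, smul_eq_mul, h1, h2,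
    dotProduct_mulAdj_mulVec, norm_toLp_sq, norm_sub_sq_real, norm_add_sq_real, inner_add_right,
    real_inner_self_eq_norm_sq]
  rw [real_inner_comm (adjoint Ξd (WithLp.toLp 2 a)) (adjoint Ξ (WithLp.toLp 2 b)),
    real_inner_comm (adjoint Ξd (WithLp.toLp 2 a)) (adjoint Υ (WithLp.toLp 2 d)),
    real_inner_comm (adjoint Ξ (WithLp.toLp 2 b)) (adjoint Υ (WithLp.toLp 2 d))]
  ring

theorem lmiMatrix_posSemidef_iff (Ξd Ξ : H10 τ →L[ℝ] Vec n) (Υ : H10 τ →L[ℝ] Vec m) (c α : ℝ)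
    {P : Matrix (Fin n) (Fin n) ℝ} (hP : Pᵀ = P) (L : Matrix (Fin m) (Fin n) ℝ) :
    (lmiMatrix Ξd Ξ Υ c α P L).PosSemidef ↔ ∀ (y b : Vec n) (d : Vec m),
      0 ≤ α * (‖adjoint Ξd y - (adjoint Ξ b + adjoint Υ d)‖ ^ 2 - c * ‖y‖ ^ 2)
        - 2 * (b.ofLp ⬝ᵥ (P *ᵥ y.ofLp) + d.ofLp ⬝ᵥ (L *ᵥ y.ofLp)) - ‖y‖ ^ 2 := by
  rw [Matrix.posSemidef_iff_dotProduct_mulVec,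
    and_iff_right (lmiMatrix_isHermitian Ξd Ξ Υ c α hP L)]
  refine ⟨fun h y b d => ?_, fun h z => ?_⟩
  · have := h (Sum.elim y.ofLp (Sum.elim b.ofLp d.ofLp))
    rwa [star_trivial, dotProduct_lmiMatrix_mulVec _ _ _ _ _ hP] at this
  · have hz : z = Sum.elim (z ∘ Sum.inl)
        (Sum.elim (z ∘ Sum.inr ∘ Sum.inl) (z ∘ Sum.inr ∘ Sum.inr)) := by
      ext (i | i | i) <;> rfl
    rw [star_trivial, hz, dotProduct_lmiMatrix_mulVec _ _ _ _ _ hP]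
    exact h _ _ _

/-- The quadratic form of the Lyapunov inequality. -/
theorem dotProduct_lyapunov_mulVec {k : Type*} [Fintype k] (M : Matrix k k ℝ)
    {P : Matrix k k ℝ} (hP : Pᵀ = P) (a : k → ℝ) :
    a ⬝ᵥ (-(M * P + P * Mᵀ) *ᵥ a) = -2 * ((a ᵥ* M) ⬝ᵥ (P *ᵥ a)) := by
  have h : P * Mᵀ = (M * P)ᵀ := by rw [Matrix.transpose_mul, hP]
  rw [h, Matrix.neg_mulVec, Matrix.add_mulVec, dotProduct_neg, dotProduct_add,
    Matrix.dotProduct_transpose_mulVec, ← Matrix.mulVec_mulVec, Matrix.dotProduct_mulVec]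
  ring

theorem lyapunov_isHermitian {k : Type*} [Fintype k] (M : Matrix k k ℝ)
    {P : Matrix k k ℝ} (hP : Pᵀ = P) : (-(M * P + P * Mᵀ)).IsHermitian := by
  rw [Matrix.IsHermitian, Matrix.conjTranspose_eq_transpose_of_trivial]
  simp [Matrix.transpose_mul, hP, add_comm]

/-- The quadratic form of the Lyapunov inequality of a closed loop. -/
theorem dotProduct_lyapunov_closedLoop_mulVec (A : Matrix (Fin n) (Fin n) ℝ)
    (B : Matrix (Fin n) (Fin m) ℝ) (K : Matrix (Fin m) (Fin n) ℝ) {P : Matrix (Fin n) (Fin n) ℝ}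
    (hP : Pᵀ = P) (a : Fin n → ℝ) :
    a ⬝ᵥ (-((A + B * K) * P + P * (A + B * K)ᵀ) *ᵥ a) =
      -2 * ((Aᵀ *ᵥ a) ⬝ᵥ (P *ᵥ a) + (Bᵀ *ᵥ a) ⬝ᵥ ((K * P) *ᵥ a)) := by
  rw [dotProduct_lyapunov_mulVec _ hP, Matrix.vecMul_add, add_dotProduct, Matrix.mulVec_transpose,
    Matrix.mulVec_transpose, ← Matrix.vecMul_vecMul, ← Matrix.dotProduct_mulVec (a ᵥ* B),
    Matrix.mulVec_mulVec]

/-- Lyapunov's criterion. -/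
theorem hurwitz_of_lyapunov {M P : Matrix (Fin n) (Fin n) ℝ} (hP : P.PosDef)
    (h : (-(M * P + P * Mᵀ)).PosDef) : Hurwitz M := by
  intro z hz
  have hPt : Pᵀ = P := by
    rw [← Matrix.conjTranspose_eq_transpose_of_trivial]
    exact hP.1
  rw [spectrum.mem_iff, Matrix.isUnit_iff_isUnit_det, isUnit_iff_ne_zero, not_not,
    ← Matrix.exists_vecMul_eq_zero_iff] at hz
  -- A left eigenvector is used because the Lyapunov form at `a` involves `a ᵥ* M`.
  obtain ⟨v, hv, hvM⟩ := hz
  set a : Fin n → ℝ := fun i => (v i).re with ha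
  set b : Fin n → ℝ := fun i => (v i).im with hb
  have hcomp : ∀ j, z * v j = ∑ i, v i * (M i j : ℂ) := by
    intro j
    have := congrFun hvM j
    rw [Matrix.vecMul_sub, Pi.sub_apply, Pi.zero_apply, sub_eq_zero, Algebra.algebraMap_eq_smul_one,
      Matrix.vecMul_smul, Matrix.vecMul_one] at this
    simpa [Matrix.vecMul, dotProduct] using this
  have haM : a ᵥ* M = z.re • a - z.im • b := by
    ext j
    have := congrArg Complex.re (hcomp j)
    simpa [Matrix.vecMul, dotProduct, ha, hb] using this.symm
  have hbM : b ᵥ* M = z.re • b + z.im • a := by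
    ext j
    have := congrArg Complex.im (hcomp j)
    simpa [Matrix.vecMul, dotProduct, ha, hb] using this.symm
  have hsymm : b ⬝ᵥ (P *ᵥ a) = a ⬝ᵥ (P *ᵥ b) := by
    rw [← Matrix.dotProduct_transpose_mulVec, hPt]
  have qa := h.posSemidef.dotProduct_mulVec_nonneg a
  have qb := h.posSemidef.dotProduct_mulVec_nonneg b
  have pa := hP.posSemidef.dotProduct_mulVec_nonneg a
  have pb := hP.posSemidef.dotProduct_mulVec_nonneg b
  have q : 0 < a ⬝ᵥ (-(M * P + P * Mᵀ) *ᵥ a) + b ⬝ᵥ (-(M * P + P * Mᵀ) *ᵥ b) := by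
    rcases eq_or_ne a 0 with h0 | h0
    · have hb0 : b ≠ 0 := by
        intro h1
        exact hv (funext fun i => Complex.ext (congrFun h0 i) (congrFun h1 i))
      exact add_pos_of_nonneg_of_pos qa (h.dotProduct_mulVec_pos hb0)
    · exact add_pos_of_pos_of_nonneg (h.dotProduct_mulVec_pos h0) qb
  -- Summed over the real and imaginary parts, the `z.im` terms cancel by symmetry of `P`, leaving
  -- `-2 z.re (a ⬝ P a + b ⬝ P b) > 0`.
  rw [dotProduct_lyapunov_mulVec _ hPt, dotProduct_lyapunov_mulVec _ hPt, haM, hbM] at q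
  simp only [sub_dotProduct, add_dotProduct, smul_dotProduct, smul_eq_mul, hsymm] at q
  simp only [star_trivial] at pa pb
  by_contra hre
  nlinarith [mul_nonneg (not_lt.1 hre) (add_nonneg pa pb)]

end Matrices

/-! ### The two implications -/

section Main

variable {τ : ℝ} {n m : ℕ}

/-- The linear matrix inequality implies the Lyapunov inequality for all compatible systems. -/
theorem posDef_lyapunov_of_lmi (hτ : 0 ≤ τ) {c : ℝ} {x : ℝ → Vec n} (hx : MemH1 τ x)
    {u : ℝ → Vec m} (hu : MemL2 τ u) {P : Matrix (Fin n) (Fin n) ℝ} {L : Matrix (Fin m) (Fin n) ℝ}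
    {α : ℝ} (hP : P.PosDef) (hα : 0 ≤ α)
    (h : (lmiMatrix (dsynthesis x hx.memL2) (synthesis x hx.memL2) (synthesis u hu)
      c α P L).PosSemidef) {A : Matrix (Fin n) (Fin n) ℝ} {B : Matrix (Fin n) (Fin m) ℝ}
    (hAB : (A, B) ∈ compatible τ c x u) :
    (-((A + B * (L * P⁻¹)) * P + P * (A + B * (L * P⁻¹))ᵀ)).PosDef := by
  have hPt : Pᵀ = P := by
    rw [← Matrix.conjTranspose_eq_transpose_of_trivial]
    exact hP.1
  have hK : L * P⁻¹ * P = L := by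
    rw [Matrix.mul_assoc, Matrix.nonsing_inv_mul _ ((Matrix.isUnit_iff_isUnit_det _).1 hP.isUnit),
      Matrix.mul_one]
  rw [Matrix.posDef_iff_dotProduct_mulVec]
  refine ⟨lyapunov_isHermitian _ hPt, fun a ha => ?_⟩
  rw [star_trivial, dotProduct_lyapunov_closedLoop_mulVec _ _ _ hPt, hK]
  have h1 := (mem_compatible_iff hτ c hx hu A B).1 hAB (WithLp.toLp 2 a)
  have h2 := (lmiMatrix_posSemidef_iff _ _ _ c α hPt L).1 h (WithLp.toLp 2 a)
    (Matrix.toEuclideanLin Aᵀ (WithLp.toLp 2 a)) (Matrix.toEuclideanLin Bᵀ (WithLp.toLp 2 a))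
  have h3 : 0 < ‖WithLp.toLp 2 a‖ ^ 2 := by
    rw [norm_toLp_sq]
    simpa using Matrix.dotProduct_star_self_pos_iff.2 ha
  have h4 := mul_nonneg hα (sub_nonneg.2 h1)
  simp only [Matrix.ofLp_toLpLin, Matrix.toLin'_apply] at h2
  linarith

/-- Informative data admit a solution of the linear matrix inequality. -/
theorem exists_lmi_of_informativeQS (hτ : 0 ≤ τ) {c : ℝ} {x : ℝ → Vec n} (hx : MemH1 τ x)
    {u : ℝ → Vec m} (hu : MemL2 τ u) (hne : (compatible τ c x u).Nonempty)
    (h : InformativeQS τ c x u) :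
    ∃ (P : Matrix (Fin n) (Fin n) ℝ) (L : Matrix (Fin m) (Fin n) ℝ) (α : ℝ),
      P.PosDef ∧ 0 ≤ α ∧
      (lmiMatrix (dsynthesis x hx.memL2) (synthesis x hx.memL2) (synthesis u hu)
        c α P L).PosSemidef := by
  obtain ⟨P, K, hP, hPK⟩ := h
  have hPt : Pᵀ = P := by
    rw [← Matrix.conjTranspose_eq_transpose_of_trivial]
    exact hP.1
  set X : Vec n →ₗ[ℝ] H10 τ := (adjoint (dsynthesis x hx.memL2)).toLinearMap with hX
  set Q : Vec n × Vec m →ₗ[ℝ] H10 τ :=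
    (adjoint (synthesis x hx.memL2)).toLinearMap.coprod (adjoint (synthesis u hu)).toLinearMap
    with hQ
  set β : Vec n →ₗ[ℝ] Vec n × Vec m →ₗ[ℝ] ℝ :=
    (innerₗ (Vec n)).compl₁₂ (Matrix.toEuclideanLin P) (LinearMap.fst ℝ (Vec n) (Vec m))
      + (innerₗ (Vec m)).compl₁₂ (Matrix.toEuclideanLin (K * P))
        (LinearMap.snd ℝ (Vec n) (Vec m)) with hβ
  have hβa : ∀ y v, β y v =
      v.1.ofLp ⬝ᵥ (P *ᵥ y.ofLp) + v.2.ofLp ⬝ᵥ ((K * P) *ᵥ y.ofLp) := by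
    intro y v
    simp [hβ, EuclideanSpace.inner_eq_star_dotProduct]
  obtain ⟨a, b, ha, hb, hab⟩ := exists_multiplier X Q β c
    (by
      obtain ⟨⟨A, B⟩, hAB⟩ := hne
      exact ⟨(Matrix.toEuclideanLin Aᵀ).prod (Matrix.toEuclideanLin Bᵀ),
        (mem_compatible_iff hτ c hx hu A B).1 hAB⟩)
    -- Linear maps `Z` correspond to pairs `(A, B)` via `Z y = (Aᵀ y, Bᵀ y)`, so every admissible
    -- `Z` comes from a compatible system.
    (fun Z hZ y hy => by
      set A : Matrix (Fin n) (Fin n) ℝ :=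
        (Matrix.toEuclideanLin.symm (LinearMap.fst ℝ (Vec n) (Vec m) ∘ₗ Z))ᵀ with hA
      set B : Matrix (Fin n) (Fin m) ℝ :=
        (Matrix.toEuclideanLin.symm (LinearMap.snd ℝ (Vec n) (Vec m) ∘ₗ Z))ᵀ with hB
      have hAZ : ∀ z, Matrix.toEuclideanLin Aᵀ z = (Z z).1 := fun z => by
        rw [hA, Matrix.transpose_transpose, LinearEquiv.apply_symm_apply]
        rfl
      have hBZ : ∀ z, Matrix.toEuclideanLin Bᵀ z = (Z z).2 := fun z => by
        rw [hB, Matrix.transpose_transpose, LinearEquiv.apply_symm_apply]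
        rfl
      have hmem : (A, B) ∈ compatible τ c x u := by
        rw [mem_compatible_iff hτ c hx hu]
        intro z
        rw [hAZ, hBZ]
        exact hZ z
      have hpos := (hPK A B hmem).dotProduct_mulVec_pos (x := y.ofLp)
        (by simpa using hy)
      rw [star_trivial, dotProduct_lyapunov_closedLoop_mulVec _ _ _ hPt] at hpos
      rw [hβa, ← hAZ, ← hBZ]
      simp only [Matrix.ofLp_toLpLin, Matrix.toLin'_apply]
      linarith)
  -- Division by `b` normalizes the coefficient of `‖y‖²` to one. Scaling `P` and `K P` together
  -- keeps the gain `K`.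
  refine ⟨b⁻¹ • P, b⁻¹ • (K * P), b⁻¹ * a, hP.smul (inv_pos.2 hb), by positivity, ?_⟩
  rw [lmiMatrix_posSemidef_iff _ _ _ _ _ (by rw [Matrix.transpose_smul, hPt])]
  intro y p q
  have h1 := mul_nonneg (inv_pos.2 hb).le (hab y (p, q))
  rw [hβa] at h1
  simp only [Matrix.smul_mulVec, dotProduct_smul, smul_eq_mul]
  refine h1.trans_eq ?_
  simp only [hX, hQ, LinearMap.coprod_apply, ContinuousLinearMap.coe_coe]
  field_simp

end Main

end DataDriven

theorem mainTheorem1 {n m : ℕ} (τ : ℝ) (hτ : 0 < τ) (c : ℝ) (hc : 0 ≤ c)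
    (x : ℝ → Vec n) (hx : MemH1 τ x) (u : ℝ → Vec m) (hu : MemL2 τ u)
    (hdata : ∃ (As : Matrix (Fin n) (Fin n) ℝ) (Bs : Matrix (Fin n) (Fin m) ℝ),
      ∃ ws ∈ noiseClass n τ c, ∀ᵐ t ∂(vol τ),
        deriv x t = Matrix.toEuclideanLin As (x t) + Matrix.toEuclideanLin Bs (u t) + ws t) :
    (InformativeQS τ c x u ↔
      ∃ (P : Matrix (Fin n) (Fin n) ℝ) (L : Matrix (Fin m) (Fin n) ℝ) (α : ℝ),
        P.PosDef ∧ 0 ≤ α ∧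
        (lmiMatrix (dsynthesis x hx.memL2) (synthesis x hx.memL2) (synthesis u hu)
          c α P L).PosSemidef) ∧
    ∀ (P : Matrix (Fin n) (Fin n) ℝ) (L : Matrix (Fin m) (Fin n) ℝ) (α : ℝ),
      P.PosDef → 0 ≤ α →
      (lmiMatrix (dsynthesis x hx.memL2) (synthesis x hx.memL2) (synthesis u hu)
        c α P L).PosSemidef →
      ∀ A B, (A, B) ∈ compatible τ c x u → Hurwitz (A + B * (L * P⁻¹)) := by
  refine ⟨⟨fun h => ?_, ?_⟩, fun P L α hP hα h A B hAB =>
    hurwitz_of_lyapunov hP (posDef_lyapunov_of_lmi hτ.le hx hu hP hα h hAB)⟩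
  · obtain ⟨As, Bs, hs⟩ := hdata
    exact exists_lmi_of_informativeQS hτ.le hx hu ⟨(As, Bs), hs⟩ h
  · rintro ⟨P, L, α, hP, hα, h⟩
    exact ⟨P, L * P⁻¹, hP, fun A B hAB => posDef_lyapunov_of_lmi hτ.le hx hu hP hα h hAB⟩
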